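/- For $q>0$ let $\zeta(z,q)$ be the Hurwitz zeta function, i.e. the analytic continuation to $z\in\mathbb{C}\setminus\{1\}$ of $\sum_{n\ge 0}(n+q)^{-z}$ ($\operatorname{Re} z>1$). For $k\in\mathbb{N}=\{1,2,\dots\}$ put $$A_k(q)=k\,\frac{\partial}{\partial z}\zeta(z,q)\Big|_{z=1-k},\qquad \psi^{(-k)}(q)=\frac{1}{k!}\bigl[A_k(q)-H_{k-1}B_k(q)\bigr],$$ where $H_r=\sum_{j=1}^{r}1/j$ (with $H_0=0$) are the harmonic numbers and $B_k(q)$ the Bernoulli polynomials, $\frac{te^{qt}}{e^t-1}=\sum_{m\ge0}B_m(q)\frac{t^m}{m!}$; the $\psi^{(-k)}$ are called the balanced negapolygamma functions. Let $\gamma$ be Euler's constant and $\zeta$ the Riemann zeta function. Then for all $k,k'\in\mathbb{N}$ the product $\psi^{(-k)}\psi^{(-k')}$ is integrable on $(0,1)$ and $$\int_0^1\psi^{(-k)}(q)\,\psi^{(-k')}(q)\,dq=\frac{2\cos\bigl((k-k')\frac{\pi}{2}\bigr)}{(2\pi)^{k+k'}}\Bigl[\zeta''(k+k')-2(\gamma+\ln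 2\pi)\,\zeta'(k+k')+\Bigl\{(\gamma+\ln 2\pi)^2+\frac{\pi^2}{4}\Bigr\}\zeta(k+k')\Bigr].$$ Moreover (from the case $k=k'=1$, where $\psi^{(-1)}(q)=\ln\Gamma(q)-\ln\sqrt{2\pi}$), $(\ln\Gamma)^2$ is integrable on $(0,1)$ and $$\int_0^1(\ln\Gamma(q))^2\,dq=\frac{\gamma^2}{12}+\frac{\pi^2}{48}+\frac13\gamma\ln\sqrt{2\pi}+\frac43\ln^2\sqrt{2\pi}-(\gamma+2\ln\sqrt{2\pi})\frac{\zeta'(2)}{\pi^2}+\frac{\zeta''(2)}{2\pi^2}.$$ -/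

import Mathlib

/-- The Hurwitz zeta function `ζ(z, q)` for real `q > 0`: the analytic continuation in `z` of
`∑ (n + q) ^ (-z)`. Mathlib's `HurwitzZeta.hurwitzZeta` is this function for `q ∈ (0, 1]`, extended
periodically in `q`; the finite sum undoes the periodic extension for `q > 1`, and it is empty
for `q ≤ 1`. -/
noncomputable def hurwitzZetaFn (z : ℂ) (q : ℝ) : ℂ :=
  HurwitzZeta.hurwitzZeta (q : UnitAddCircle) z -
    ∑ n ∈ Finset.range (⌈q⌉₊ - 1), 1 / ((q : ℂ) - ((n : ℂ) + 1)) ^ z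

/-- On `q ≤ 1` the correction is empty. -/
theorem hurwitzZetaFn_of_le_one (z : ℂ) {q : ℝ} (hq : q ≤ 1) :
    hurwitzZetaFn z q = HurwitzZeta.hurwitzZeta (q : UnitAddCircle) z := by
  have h : ⌈q⌉₊ - 1 = 0 := by
    have : ⌈q⌉₊ ≤ 1 := Nat.ceil_le.mpr (by simpa using hq)
    omega
  simp [hurwitzZetaFn, h]

/-- `hurwitzZetaFn` is given by the Hurwitz series where the series converges. -/
theorem hasSum_hurwitzZetaFn {z : ℂ} {q : ℝ} (hz : 1 < z.re) (hq : 0 < q) :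
    HasSum (fun n : ℕ => 1 / ((n : ℂ) + (q : ℂ)) ^ z) (hurwitzZetaFn z q) := by
  obtain ⟨m, hm⟩ : ∃ m, ⌈q⌉₊ = m + 1 :=
    Nat.exists_eq_succ_of_ne_zero (Nat.ceil_pos.mpr hq).ne'
  have h1 : (m : ℝ) < q := Nat.lt_ceil.mp (by omega)
  have h2 : q ≤ m + 1 := by
    have := Nat.le_ceil q
    rw [hm] at this
    exact_mod_cast this
  have key := HurwitzZeta.hasSum_hurwitzZeta_of_one_lt_re (a := q - m)
    ⟨by linarith, by linarith⟩ hz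
  have hper : ((q - m : ℝ) : UnitAddCircle) = (q : UnitAddCircle) := by
    have h0 : ((m : ℝ) : UnitAddCircle) = 0 := by
      rw [AddCircle.coe_eq_zero_iff]
      exact ⟨m, by simp⟩
    rw [AddCircle.coe_sub, h0, sub_zero]
  rw [hper] at key
  have key2 := (hasSum_nat_add_iff' m).mpr key
  unfold hurwitzZetaFn
  rw [hm, Nat.add_sub_cancel]
  have hf : (fun n : ℕ => 1 / (((n + m : ℕ) : ℂ) + ((q - m : ℝ) : ℂ)) ^ z) =
      fun n : ℕ => 1 / ((n : ℂ) + (q : ℂ)) ^ z := by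
    funext n
    have e : ((n + m : ℕ) : ℂ) + ((q - m : ℝ) : ℂ) = (n : ℂ) + (q : ℂ) := by
      push_cast
      ring
    rw [e]
  have hs : ∑ i ∈ Finset.range m, 1 / ((i : ℂ) + ((q - m : ℝ) : ℂ)) ^ z =
      ∑ n ∈ Finset.range m, 1 / ((q : ℂ) - ((n : ℂ) + 1)) ^ z := by
    rw [← Finset.sum_range_reflect]
    refine Finset.sum_congr rfl fun i hi => ?_
    have hi' : i + 1 ≤ m := Finset.mem_range.mp hi
    have e : ((m - 1 - i : ℕ) : ℂ) + ((q - m : ℝ) : ℂ) = (q : ℂ) - ((i : ℂ) + 1) := by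
      rw [Nat.sub_sub, Nat.cast_sub (by omega)]
      push_cast
      ring
    rw [e]
  rw [← hs, ← hf]
  exact key2

/-- `hurwitzZetaFn` is holomorphic in `z` away from its pole `z = 1`. -/
theorem differentiableAt_hurwitzZetaFn {z : ℂ} (q : ℝ) (hz : z ≠ 1) :
    DifferentiableAt ℂ (fun w => hurwitzZetaFn w q) z := by
  unfold hurwitzZetaFn
  refine (HurwitzZeta.differentiableAt_hurwitzZeta _ hz).sub
    (DifferentiableAt.fun_sum fun n hn => ?_)
  have hn' : n + 1 < ⌈q⌉₊ := by
    have := Finset.mem_range.mp hn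
    omega
  have h1 : ((n + 1 : ℕ) : ℝ) < q := Nat.lt_ceil.mp hn'
  have hne : (q : ℂ) - ((n : ℂ) + 1) ≠ 0 := by
    have h2 : q - ((n : ℝ) + 1) ≠ 0 := by
      push_cast at h1
      linarith
    exact_mod_cast h2
  have hpow : DifferentiableAt ℂ (fun w : ℂ => ((q : ℂ) - ((n : ℂ) + 1)) ^ w) z :=
    differentiableAt_id.const_cpow (Or.inl hne)
  exact (differentiableAt_const _).div hpow (by simp [Complex.cpow_eq_zero_iff, hne])

/-- `A_k(q) = k ∂ζ(z, q)/∂z` at `z = 1 - k`. -/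
noncomputable def hurwitzA (k : ℕ) (q : ℝ) : ℂ :=
  (k : ℂ) * deriv (fun z : ℂ => hurwitzZetaFn z q) (1 - (k : ℂ))

/-- The balanced negapolygamma function `ψ^{(-k)}(q) = (A_k(q) - H_{k-1} B_k(q)) / k!`, `k ≥ 1`,
with `H_r` the harmonic numbers and `B_k` the Bernoulli polynomials. -/
noncomputable def negapolygamma (k : ℕ) (q : ℝ) : ℂ :=
  (1 / (k.factorial : ℂ)) *
    (hurwitzA k q - (harmonic (k - 1) : ℂ) * Polynomial.aeval (q : ℂ) (Polynomial.bernoulli k))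

/-! The formula is Parseval's identity on (0,1). Differentiating Hurwitz's formula, which expresses
ζ(1-s, q) through the series ∑ e^{±2πinq} n^{-s}, yields the Fourier coefficients of ∂ζ(z, ·) at z =
1-s. At s = k they contain Γ'(k)/Γ(k) = -γ + H_{k-1}, and the term -H_{k-1} B_k in ψ^{(-k)} removes
exactly this H_{k-1}. Hence ψ^{(-k)} has mean zero and, with c = γ + ln 2π, coefficients (c + ln n ±
πi/2)/(±2πin)^k at ±n (`fourierCoeffOn_negapolygamma`). In the product of opposite modes the
numerators give (c + ln n)² + π²/4, whose Dirichlet series is a combination of ζ'', ζ' and ζ, while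
the powers of ±i add up to the cosine.

For k ≥ 2 the Fourier series converges absolutely and its coefficients can be read off. For k = 1 it
does not, and the coefficients are limits as s → 1+ under dominated convergence. The bound C + |ln
q| needed there comes from writing ζ(z,q) - ζ(z) as q^{-z} - q plus a series converging uniformly
near z = 0 (`hurwitzZeta_sub_riemannZeta_eq`). The same series gives square integrability and
Lerch's formula, hence the link with ln Γ. -/

/-! ### Fourier coefficients and Parseval on the unit interval. -/

theorem fourierCoeffOn_zero_one_eq (f : ℝ → ℂ) (n : ℤ) :
    fourierCoeffOn (zero_lt_one' ℝ) f n =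
      ∫ q in (0 : ℝ)..1, fourier (-n) (q : UnitAddCircle) * f q := by
  rw [fourierCoeffOn_eq_integral]
  simp only [fourier_coe_apply, sub_zero, smul_eq_mul, div_one, one_smul]

theorem fourierCoeffOn_zero_one_eq_fourierCoeff (f : UnitAddCircle → ℂ) (n : ℤ) :
    fourierCoeffOn (zero_lt_one' ℝ) (fun q => f q) n = fourierCoeff f n := by
  rw [fourierCoeffOn_zero_one_eq, fourierCoeff_eq_intervalIntegral f n 0]
  simp

open MeasureTheory in
theorem fourierCoeffOn_zero_one_add {f g : ℝ → ℂ} (hf : IntervalIntegrable f volume 0 1)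
    (hg : IntervalIntegrable g volume 0 1) (n : ℤ) :
    fourierCoeffOn (zero_lt_one' ℝ) (fun q => f q + g q) n =
      fourierCoeffOn (zero_lt_one' ℝ) f n + fourierCoeffOn (zero_lt_one' ℝ) g n := by
  have hc : Continuous fun q : ℝ => fourier (-n) (q : UnitAddCircle) :=
    (map_continuous _).comp (AddCircle.continuous_mk' 1)
  simp only [fourierCoeffOn_zero_one_eq, mul_add]
  exact intervalIntegral.integral_add (hf.continuousOn_mul hc.continuousOn)
    (hg.continuousOn_mul hc.continuousOn)

-- Parseval for the inner product of conj f with g: conjugating f reverses its frequencies, which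
-- makes the identity bilinear.
open MeasureTheory AddCircle ComplexConjugate in
theorem hasSum_fourierCoeff_mul {f g : UnitAddCircle → ℂ} (hf : MemLp f 2 haarAddCircle)
    (hg : MemLp g 2 haarAddCircle) :
    HasSum (fun n : ℤ => fourierCoeff f (-n) * fourierCoeff g n)
      (∫ t, f t * g t ∂haarAddCircle) := by
  have hf' : MemLp (fun t => conj (f t)) 2 (haarAddCircle (T := 1)) := hf.star
  have h := (fourierBasis (T := 1)).hasSum_inner_mul_inner hf'.toLp hg.toLp
  rw [L2.inner_def] at h
  convert! h using 1
  · funext n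
    congr 1
    · rw [coe_fourierBasis, L2.inner_def, fourierCoeff]
      refine integral_congr_ae ?_
      filter_upwards [hf'.coeFn_toLp, coeFn_fourierLp (T := 1) 2 n] with t h1 h2
      rw [h1, h2]
      simp
    · rw [← HilbertBasis.repr_apply_apply, fourierBasis_repr, fourierCoeff_congr_ae hg.coeFn_toLp]
  · refine integral_congr_ae ?_
    filter_upwards [hf'.coeFn_toLp, hg.coeFn_toLp] with t h1 h2
    simp [h1, h2, mul_comm]

open MeasureTheory AddCircle in
theorem hasSum_fourierCoeffOn_mul {f g : ℝ → ℂ} (hf : MemLp f 2 (volume.restrict (Set.Ioc 0 1)))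
    (hg : MemLp g 2 (volume.restrict (Set.Ioc 0 1))) :
    HasSum (fun n : ℤ => fourierCoeffOn (zero_lt_one' ℝ) f (-n) *
      fourierCoeffOn (zero_lt_one' ℝ) g n) (∫ q in (0 : ℝ)..1, f q * g q) := by
  have hone : (0 : ℝ) + 1 = 1 := zero_add 1
  rw [← hone] at hf hg
  have h := hasSum_fourierCoeff_mul hf.memLp_liftIoc.haarAddCircle hg.memLp_liftIoc.haarAddCircle
  simp only [fourierCoeff_liftIoc_eq, zero_add] at h
  convert h using 1
  rw [integral_haarAddCircle, inv_one, one_smul]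
  have := integral_liftIoc_eq_intervalIntegral (T := 1) (t := 0) (f := fun q => f q * g q)
  rw [zero_add] at this
  rw [← this]
  rfl

-- Absolute convergence permits termwise integration. The frequencies `e` may repeat, so a
-- coefficient is itself a sum.
open MeasureTheory AddCircle in
theorem fourierCoeff_of_hasSum {ι : Type*} [Countable ι] {A : ι → ℂ} (hA : Summable A) (e : ι → ℤ)
    {g : UnitAddCircle → ℂ} (hg : ∀ a, HasSum (fun i => A i * fourier (e i) a) (g a)) :
    Continuous g ∧
      ∀ m, HasSum (fun i => if e i = m then A i else 0) (fourierCoeff g m) := by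
  have hbd : ∀ i (a : UnitAddCircle), ‖A i * fourier (e i) a‖ ≤ ‖A i‖ := fun i a => by
    rw [norm_mul, fourier_apply, Circle.norm_coe, mul_one]
  have hgeq : g = fun a => ∑' i, A i * fourier (e i) a := funext fun a => (hg a).tsum_eq.symm
  refine ⟨?_, fun m => ?_⟩
  · rw [hgeq]
    exact continuous_tsum (fun i => continuous_const.mul (map_continuous _)) hA.norm hbd
  · have hint := hasSum_integral_of_summable_integral_norm
      (μ := haarAddCircle (T := 1))
      (F := fun i (a : UnitAddCircle) => fourier (-m) a • (A i * fourier (e i) a))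
      (fun i => by
        refine Continuous.integrable_of_hasCompactSupport (by fun_prop) ?_
        exact HasCompactSupport.of_compactSpace _) (by
        simp only [smul_eq_mul, norm_mul, fourier_apply, Circle.norm_coe, mul_one, one_mul]
        simpa using hA.norm)
    have e1 : ∀ i, ∫ a : UnitAddCircle, fourier (-m) a • (A i * fourier (e i) a) ∂haarAddCircle
        = if e i = m then A i else 0 := fun i => by
      have := congrFun (fourierCoeff_fourier (T := 1) (e i)) m
      change fourierCoeff (A i • ⇑(fourier (e i))) m = _
      rw [fourierCoeff.const_smul, this, Pi.single_apply]
      simp [eq_comm]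
    simp only [e1] at hint
    have hco : fourierCoeff g m = ∫ a, ∑' i, fourier (-m) a • (A i * fourier (e i) a)
        ∂haarAddCircle (T := 1) := by
      refine integral_congr_ae (Filter.Eventually.of_forall fun a => ?_)
      exact ((hg a).mul_left (fourier (-m) a)).tsum_eq.symm
    rwa [hco]

/-- The two one-sided series share only frequency 0; `A 0 = B 0 = 0` removes that overlap. -/
theorem fourierCoeff_add_of_hasSum_nat {A B : ℕ → ℂ} (hA : Summable A) (hB : Summable B)
    (hA0 : A 0 = 0) (hB0 : B 0 = 0) {g₁ g₂ : UnitAddCircle → ℂ}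
    (h₁ : ∀ a, HasSum (fun n : ℕ => A n * fourier (n : ℤ) a) (g₁ a))
    (h₂ : ∀ a, HasSum (fun n : ℕ => B n * fourier (-n : ℤ) a) (g₂ a)) :
    Continuous (fun a => g₁ a + g₂ a) ∧
      ∀ n : ℕ, fourierCoeff (fun a => g₁ a + g₂ a) n = A n ∧
        fourierCoeff (fun a => g₁ a + g₂ a) (-n) = B n := by
  obtain ⟨c₁, d₁⟩ := fourierCoeff_of_hasSum hA (fun n => (n : ℤ)) h₁
  obtain ⟨c₂, d₂⟩ := fourierCoeff_of_hasSum hB (fun n => (-n : ℤ)) h₂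
  refine ⟨c₁.add c₂, fun n => ?_⟩
  have hadd := fourierCoeff.add (T := 1)
    (c₁.integrable_of_hasCompactSupport (HasCompactSupport.of_compactSpace _))
    (c₂.integrable_of_hasCompactSupport (HasCompactSupport.of_compactSpace _))
  have hadd' : ∀ m, fourierCoeff (fun a => g₁ a + g₂ a) m = fourierCoeff g₁ m + fourierCoeff g₂ m :=
    fun m => congrFun hadd m
  have single : ∀ {C : ℕ → ℂ} {e : ℕ → ℤ} {m : ℤ} {x : ℂ} (N : ℕ),
      HasSum (fun i => if e i = m then C i else 0) x → (∀ i, e i = m → i = N ∨ C i = 0) →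
      x = if e N = m then C N else 0 := by
    intro C e m x N h hN
    refine h.unique (hasSum_single N fun i hi => ?_)
    split_ifs with h'
    · exact (hN i h').resolve_left hi
    · rfl
  have h0 : ∀ i : ℕ, i = 0 → A i = 0 ∧ B i = 0 := by rintro _ rfl; exact ⟨hA0, hB0⟩
  rw [hadd', hadd', single n (d₁ n) (by intro i hi; left; exact_mod_cast hi),
    single n (d₂ n) (by intro i hi; right; exact (h0 i (by omega)).2),
    single n (d₁ (-n)) (by intro i hi; right; exact (h0 i (by omega)).1),
    single n (d₂ (-n)) (by intro i hi; left; omega)]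
  rcases Nat.eq_zero_or_pos n with rfl | hn
  · simp [hA0, hB0]
  · have : (-n : ℤ) ≠ n := by omega
    simp [this, this.symm]

/-! ### The differentiated functional equation for Re s > 1. -/

/-- The factor `(2π)^{-s} Γ(s) e^{επis/2}` of the functional equation of the Hurwitz zeta
function. -/
noncomputable def hurwitzFactor (ε s : ℂ) : ℂ :=
  (2 * (Real.pi : ℂ)) ^ (-s) * Complex.Gamma s *
    Complex.exp (ε * ((Real.pi : ℂ) * Complex.I * s / 2))

/-- The Fourier coefficients of `∂_zζ(z, ·)` at `z = 1 - s`. -/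
noncomputable def hurwitzDerivCoeff (ε s : ℂ) (n : ℕ) : ℂ :=
  (hurwitzFactor ε s * Complex.log n - deriv (hurwitzFactor ε) s) * (n : ℂ) ^ (-s)

open Complex in
theorem hasDerivAt_hurwitzFactor (ε : ℂ) {s : ℂ} (hs : 0 < s.re) :
    HasDerivAt (hurwitzFactor ε) ((2 * (Real.pi : ℂ)) ^ (-s) * exp (ε * (Real.pi * I * s / 2)) *
      (deriv Gamma s + Gamma s * (ε * (Real.pi * I / 2) - log (2 * Real.pi)))) s := by
  have hG : HasDerivAt Gamma (deriv Gamma s) s :=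
    (differentiableAt_Gamma s fun m h => by
      have := congrArg re h
      simp only [neg_re, natCast_re] at this
      have : (0 : ℝ) ≤ m := Nat.cast_nonneg m
      linarith).hasDerivAt
  have hpi : (2 * (Real.pi : ℂ)) ≠ 0 := by simp [Real.pi_ne_zero]
  have h1 : HasDerivAt (fun s : ℂ => (2 * (Real.pi : ℂ)) ^ (-s))
      ((2 * (Real.pi : ℂ)) ^ (-s) * log (2 * Real.pi) * (-1)) s :=
    (hasDerivAt_neg s).const_cpow (Or.inl hpi)
  have h2 : HasDerivAt (fun s : ℂ => exp (ε * (Real.pi * I * s / 2)))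
      (exp (ε * (Real.pi * I * s / 2)) * (ε * (Real.pi * I * 1 / 2))) s :=
    ((((hasDerivAt_id s).const_mul (Real.pi * I)).div_const 2).const_mul ε).cexp
  refine ((h1.mul hG).mul h2).congr_deriv ?_
  simp only [Pi.mul_apply]
  ring

open Complex in
theorem hurwitzDerivCoeff_zero_right (ε : ℂ) {s : ℂ} (hs : 0 < s.re) :
    hurwitzDerivCoeff ε s 0 = 0 := by
  have : -s ≠ 0 := fun h => by simp [neg_eq_zero.mp h] at hs
  simp [hurwitzDerivCoeff, this]

open Complex in
theorem continuousAt_hurwitzDerivCoeff (ε : ℂ) (n : ℕ) {s : ℂ} (hs : 0 < s.re) :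
    ContinuousAt (fun s => hurwitzDerivCoeff ε s n) s := by
  have hopen : IsOpen {s : ℂ | 0 < s.re} := isOpen_lt continuous_const continuous_re
  rcases eq_or_ne n 0 with rfl | hn
  · refine (continuousAt_const (y := (0 : ℂ))).congr ?_
    filter_upwards [hopen.mem_nhds hs] with w hw
    exact (hurwitzDerivCoeff_zero_right ε hw).symm
  have hd : DifferentiableOn ℂ (hurwitzFactor ε) {s : ℂ | 0 < s.re} := fun w hw =>
    (hasDerivAt_hurwitzFactor ε hw).differentiableAt.differentiableWithinAt
  have h1 := (hd.deriv hopen).differentiableAt (hopen.mem_nhds hs)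
  have h2 := hd.differentiableAt (hopen.mem_nhds hs)
  have h3 : ContinuousAt (fun s : ℂ => (n : ℂ) ^ (-s)) s :=
    (continuous_neg.const_cpow (Or.inl (by exact_mod_cast hn))).continuousAt
  exact ((h2.continuousAt.mul continuousAt_const).sub h1.continuousAt).mul h3

open Complex LSeries in
theorem abscissaOfAbsConv_fourier_le_one (a : UnitAddCircle) :
    abscissaOfAbsConv (fun n : ℕ => fourier (n : ℤ) a) ≤ 1 :=
  abscissaOfAbsConv_le_of_le_const ⟨1, fun n _ => by rw [fourier_apply, Circle.norm_coe]⟩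

open Complex LSeries HurwitzZeta in
theorem expZeta_eq_LSeries (a : UnitAddCircle) {s : ℂ} (hs : 1 < s.re) :
    expZeta a s = LSeries (fun n : ℕ => fourier (n : ℤ) a) s := by
  induction a using QuotientAddGroup.induction_on with
  | H x =>
    rw [← (LSeriesHasSum_exp x hs).LSeries_eq]
    congr 1
    funext n
    erw [fourier_coe_apply]
    congr 1
    push_cast
    ring

open Complex LSeries HurwitzZeta in
theorem hasDerivAt_expZeta (a : UnitAddCircle) {s : ℂ} (hs : 1 < s.re) :
    HasDerivAt (expZeta a) (-LSeries (logMul fun n : ℕ => fourier (n : ℤ) a) s) s := by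
  have habs : abscissaOfAbsConv (fun n : ℕ => fourier (n : ℤ) a) < s.re :=
    (abscissaOfAbsConv_fourier_le_one a).trans_lt (by exact_mod_cast hs)
  refine (LSeries_hasDerivAt habs).congr_of_eventuallyEq ?_
  filter_upwards [(isOpen_lt continuous_const continuous_re).mem_nhds hs] with w hw
  exact expZeta_eq_LSeries a hw

open Complex LSeries in
theorem term_eq_mul_cpow_neg (f : ℕ → ℂ) {s : ℂ} (hs : s ≠ 0) (n : ℕ) :
    term f s n = f n * (n : ℂ) ^ (-s) := by
  rw [term_of_ne_zero' hs, cpow_neg, div_eq_mul_inv]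

-- The product rule for the factor times ∑ e^{2πina} n^{-s}, where differentiating the series brings
-- down -ln n.
open Complex LSeries HurwitzZeta in
theorem hasSum_hurwitzDerivCoeff (ε : ℂ) (a : UnitAddCircle) {s : ℂ} (hs : 1 < s.re) :
    HasSum (fun n : ℕ => hurwitzDerivCoeff ε s n * fourier (n : ℤ) a)
      (-(deriv (hurwitzFactor ε) s * expZeta a s + hurwitzFactor ε s * deriv (expZeta a) s)) := by
  have habs : abscissaOfAbsConv (fun n : ℕ => fourier (n : ℤ) a) < s.re :=
    (abscissaOfAbsConv_fourier_le_one a).trans_lt (by exact_mod_cast hs)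
  have hs0 : s ≠ 0 := fun h => by simp [h] at hs; linarith
  have h1 :=
    (LSeriesSummable_of_abscissaOfAbsConv_lt_re habs).LSeriesHasSum
  have h2 :=
    (LSeriesSummable_logMul_of_lt_re habs).LSeriesHasSum
  rw [(hasDerivAt_expZeta a hs).deriv, expZeta_eq_LSeries a hs]
  convert! (h2.mul_left (hurwitzFactor ε s)).sub (h1.mul_left (deriv (hurwitzFactor ε) s)) using 1
  · funext n
    rw [term_eq_mul_cpow_neg _ hs0, term_eq_mul_cpow_neg _ hs0, hurwitzDerivCoeff, logMul]
    ring
  · ring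

open Complex LSeries HurwitzZeta in
theorem summable_hurwitzDerivCoeff (ε : ℂ) {s : ℂ} (hs : 1 < s.re) :
    Summable (hurwitzDerivCoeff ε s) := by
  have := (hasSum_hurwitzDerivCoeff ε 0 hs).summable
  simpa using this

-- Both sides of Hurwitz's formula are differentiated in s; the outer minus signs come from the
-- inner function 1 - s.
open Complex HurwitzZeta in
theorem deriv_hurwitzZeta_one_sub (a : UnitAddCircle) {s : ℂ} (hs : 1 < s.re) :
    deriv (hurwitzZeta a) (1 - s) =
      -(deriv (hurwitzFactor (-1)) s * expZeta a s + hurwitzFactor (-1) s * deriv (expZeta a) s) +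
      -(deriv (hurwitzFactor 1) s * expZeta (-a) s +
        hurwitzFactor 1 s * deriv (expZeta (-a)) s) := by
  have hs0 : 0 < s.re := by linarith
  have hF : ∀ ε, HasDerivAt (hurwitzFactor ε) (deriv (hurwitzFactor ε) s) s := fun ε =>
    (hasDerivAt_hurwitzFactor ε hs0).differentiableAt.hasDerivAt
  have hE : ∀ b, HasDerivAt (expZeta b) (deriv (expZeta b) s) s := fun b =>
    (hasDerivAt_expZeta b hs).differentiableAt.hasDerivAt
  have hR := ((hF (-1)).mul (hE a)).add ((hF 1).mul (hE (-a)))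
  have hZ : DifferentiableAt ℂ (hurwitzZeta a) (1 - s) :=
    differentiableAt_hurwitzZeta a fun h => by
      have : s = 0 := by linear_combination -h
      simp [this] at hs0
  have hL : HasDerivAt (fun w => hurwitzZeta a (1 - w)) (deriv (hurwitzZeta a) (1 - s) * -1) s :=
    hZ.hasDerivAt.comp s ((hasDerivAt_id s).const_sub 1)
  have heq := hL.unique (hR.congr_of_eventuallyEq (by
    filter_upwards [(isOpen_lt continuous_const continuous_re).mem_nhds hs] with w hw
    have hw' : 1 < w.re := hw
    rw [hurwitzZeta_one_sub a (fun n h => by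
      rw [h] at hw'
      simp only [neg_re, natCast_re] at hw'
      have : (0 : ℝ) ≤ n := Nat.cast_nonneg n
      linarith) (Or.inr fun h => by simp [h] at hw')]
    simp only [Pi.add_apply, Pi.mul_apply, hurwitzFactor]
    rw [show -(Real.pi : ℂ) * I * w / 2 = -1 * (Real.pi * I * w / 2) by ring,
      one_mul (_ / 2)]
    ring))
  linear_combination -heq

open Complex HurwitzZeta in
/-- Away from the critical case, `∂_zζ(z, ·)` is continuous on the circle, with explicit Fourier
coefficients. -/
theorem fourierCoeff_deriv_hurwitzZeta {s : ℂ} (hs : 1 < s.re) :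
    Continuous (fun a : UnitAddCircle => deriv (hurwitzZeta a) (1 - s)) ∧ ∀ n : ℕ,
      fourierCoeff (fun a : UnitAddCircle => deriv (hurwitzZeta a) (1 - s)) n =
        hurwitzDerivCoeff (-1) s n ∧
      fourierCoeff (fun a : UnitAddCircle => deriv (hurwitzZeta a) (1 - s)) (-n) =
        hurwitzDerivCoeff 1 s n := by
  have h0 := fun ε => hurwitzDerivCoeff_zero_right ε (zero_lt_one.trans hs)
  have := fourierCoeff_add_of_hasSum_nat (summable_hurwitzDerivCoeff (-1) hs)
    (summable_hurwitzDerivCoeff 1 hs) (h0 _) (h0 _)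
    (fun a => hasSum_hurwitzDerivCoeff (-1) a hs)
    (g₂ := fun a => -(deriv (hurwitzFactor 1) s * expZeta (-a) s +
        hurwitzFactor 1 s * deriv (expZeta (-a)) s))
    (fun a => by simpa [fourier_apply] using hasSum_hurwitzDerivCoeff 1 (-a) hs)
  simpa only [← deriv_hurwitzZeta_one_sub _ hs] using this

/-! ### Expansion of the Hurwitz zeta function near z = 0. -/

/-- The deviation of `t ↦ t ^ (-z)` at `n + 1 + q` from its linear interpolation on
`[n + 1, n + 2]`. -/
noncomputable def cpowInterpError (q : ℝ) (n : ℕ) (z : ℂ) : ℂ :=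
  ((n + 1 + q : ℝ) : ℂ) ^ (-z) - ((n + 1 : ℝ) : ℂ) ^ (-z) -
    q * (((n + 2 : ℝ) : ℂ) ^ (-z) - ((n + 1 : ℝ) : ℂ) ^ (-z))

/-- A convex region containing `0` and meeting the half plane of convergence. -/
def hurwitzRegion : Set ℂ := {z | -(1 / 2) < z.re} ∩ Metric.ball 0 3

theorem isOpen_hurwitzRegion : IsOpen hurwitzRegion :=
  (isOpen_lt continuous_const Complex.continuous_re).inter Metric.isOpen_ball

theorem convex_hurwitzRegion : Convex ℝ hurwitzRegion :=
  (convex_halfSpace_re_gt _).inter (convex_ball _ _)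

theorem hasDerivAt_ofReal_cpow (w : ℂ) {t : ℝ} (ht : 0 < t) :
    HasDerivAt (fun t : ℝ => (t : ℂ) ^ w) (w * (t : ℂ) ^ (w - 1)) t := by
  have h := (hasDerivAt_id (t : ℂ)).cpow_const (c := w)
    (Complex.ofReal_mem_slitPlane.mpr ht)
  simpa using h.comp_ofReal

/-- Linear interpolation has a second-order error: the second derivative z(z+1)t^{-z-2} is at most
3·4·b^{-3/2} on t ≥ b = n + 1, as |z| < 3 and Re z > -1/2. -/
theorem norm_cpowInterpError_le {q : ℝ} (hq0 : 0 ≤ q) (hq1 : q ≤ 1) (n : ℕ) {z : ℂ}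
    (hz : z ∈ hurwitzRegion) :
    ‖cpowInterpError q n z‖ ≤ 12 * ((n + 1 : ℕ) : ℝ) ^ (-(3 / 2) : ℝ) := by
  obtain ⟨hre, hz3⟩ := hz
  have hre : -(1 / 2) < z.re := hre
  rw [mem_ball_zero_iff] at hz3
  set b : ℝ := n + 1 with hb
  have hb1 : 1 ≤ b := by simp [hb]
  set C : ℝ := 12 * b ^ (-(3 / 2) : ℝ) with hC
  have hC0 : 0 ≤ C := by positivity
  have hbound : ∀ t ∈ Set.Ici b, ‖-z * ((-z - 1) * (t : ℂ) ^ (-z - 1 - 1))‖ ≤ C := by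
    intro t ht
    have ht : b ≤ t := ht
    have ht0 : 0 < t := by linarith
    rw [norm_mul, norm_mul, norm_neg, Complex.norm_cpow_eq_rpow_re_of_pos ht0, ← mul_assoc]
    have h1 : ‖-z - 1‖ ≤ 4 := by
      calc ‖-z - 1‖ ≤ ‖-z‖ + ‖(1 : ℂ)‖ := norm_sub_le _ _
        _ ≤ 4 := by rw [norm_neg, norm_one]; linarith
    have h2 : t ^ (-z - 1 - 1).re ≤ b ^ (-(3 / 2) : ℝ) := by
      calc t ^ (-z - 1 - 1).re ≤ t ^ (-(3 / 2) : ℝ) := by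
            refine Real.rpow_le_rpow_of_exponent_le (by linarith) ?_
            simp only [Complex.sub_re, Complex.neg_re, Complex.one_re]
            linarith
        _ ≤ b ^ (-(3 / 2) : ℝ) :=
            Real.rpow_le_rpow_of_nonpos (by linarith) ht (by norm_num)
    have h3 : ‖z‖ * ‖-z - 1‖ ≤ 12 := by nlinarith [norm_nonneg z, norm_nonneg (-z - 1)]
    exact mul_le_mul h3 h2 (by positivity) (by norm_num)
  have hmv1 : ∀ x ∈ Set.Ici b, ∀ y ∈ Set.Ici b,
      ‖-z * (y : ℂ) ^ (-z - 1) - -z * (x : ℂ) ^ (-z - 1)‖ ≤ C * ‖y - x‖ := by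
    intro x hx y hy
    refine (convex_Ici b).norm_image_sub_le_of_norm_hasDerivWithin_le
      (f := fun t : ℝ => -z * (t : ℂ) ^ (-z - 1))
      (f' := fun t : ℝ => -z * ((-z - 1) * (t : ℂ) ^ (-z - 1 - 1))) (fun t ht => ?_) hbound hx hy
    have ht : b ≤ t := ht
    exact ((hasDerivAt_ofReal_cpow _ (by linarith)).const_mul _).hasDerivWithinAt
  -- With φ(t) = t^{-z}, the error is g(1) - g(0) for g(t) = φ(b + qt) - qφ(b + t), and g' is q
  -- times an increment of φ' over a distance at most 1.
  have hder : ∀ t ∈ Set.Icc (0 : ℝ) 1, HasDerivWithinAt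
      (fun t : ℝ => ((b + q * t : ℝ) : ℂ) ^ (-z) - q * ((b + t : ℝ) : ℂ) ^ (-z))
      (q * (-z * ((b + q * t : ℝ) : ℂ) ^ (-z - 1) - -z * ((b + t : ℝ) : ℂ) ^ (-z - 1)))
      (Set.Icc (0 : ℝ) 1) t := by
    intro t ht
    have hqt : 0 ≤ q * t := mul_nonneg hq0 ht.1
    have i1 : HasDerivAt (fun t : ℝ => b + q * t) q t := by
      simpa using ((hasDerivAt_id t).const_mul q).const_add b
    have i2 : HasDerivAt (fun t : ℝ => b + t) 1 t := by
      simpa using (hasDerivAt_id t).const_add b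
    have d1 := (hasDerivAt_ofReal_cpow (-z) (t := b + q * t) (by linarith)).scomp t i1
    have d2 := (hasDerivAt_ofReal_cpow (-z) (t := b + t) (by linarith [ht.1])).scomp t i2
    refine ((d1.sub (d2.const_mul (q : ℂ))).congr_deriv ?_).hasDerivWithinAt
    simp only [Complex.real_smul, one_smul]
    ring
  have hle : ∀ t ∈ Set.Icc (0 : ℝ) 1,
      ‖(q : ℂ) * (-z * ((b + q * t : ℝ) : ℂ) ^ (-z - 1) - -z * ((b + t : ℝ) : ℂ) ^ (-z - 1))‖
        ≤ C := by
    intro t ht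
    have hqt : 0 ≤ q * t := mul_nonneg hq0 ht.1
    have hqt' : q * t ≤ t := mul_le_of_le_one_left ht.1 hq1
    have h1 := hmv1 (b + t) (by simp [ht.1]) (b + q * t) (by simp [hqt])
    have h2 : ‖b + q * t - (b + t)‖ ≤ 1 := by
      rw [Real.norm_eq_abs, abs_le]
      constructor <;> linarith [ht.2]
    rw [norm_mul, Complex.norm_real, Real.norm_eq_abs, abs_of_nonneg hq0]
    calc _ ≤ 1 * (C * 1) := by gcongr; exact h1.trans (by gcongr)
      _ = C := by ring
  have hfin := (convex_Icc (0 : ℝ) 1).norm_image_sub_le_of_norm_hasDerivWithin_le hder hle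
    (Set.left_mem_Icc.mpr zero_le_one) (Set.right_mem_Icc.mpr zero_le_one)
  have e : cpowInterpError q n z =
      (((b + q * 1 : ℝ) : ℂ) ^ (-z) - q * ((b + 1 : ℝ) : ℂ) ^ (-z)) -
      (((b + q * 0 : ℝ) : ℂ) ^ (-z) - q * ((b + 0 : ℝ) : ℂ) ^ (-z)) := by
    rw [cpowInterpError, mul_one, mul_zero, add_zero, hb, show (n + 1 + 1 : ℝ) = n + 2 by ring]
    ring
  rw [e]
  refine hfin.trans (le_of_eq ?_)
  rw [hC, hb]
  simp

theorem summable_cpowInterpError_bound :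
    Summable fun n : ℕ => 12 * ((n + 1 : ℕ) : ℝ) ^ (-(3 / 2) : ℝ) :=
  ((summable_nat_add_iff (f := fun n : ℕ => (n : ℝ) ^ (-(3 / 2) : ℝ)) 1).mpr
    (Real.summable_nat_rpow.mpr (by norm_num))).mul_left 12

theorem hasDerivAt_const_cpow_neg {c : ℝ} (hc : 0 < c) (z : ℂ) :
    HasDerivAt (fun z : ℂ => (c : ℂ) ^ (-z)) (-((c : ℂ) ^ (-z) * Real.log c)) z := by
  have h := (hasDerivAt_neg z).const_cpow (c := (c : ℂ)) (Or.inl (by exact_mod_cast hc.ne'))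
  refine h.congr_deriv ?_
  rw [Complex.ofReal_log hc.le]
  ring

theorem hasDerivAt_cpowInterpError {q : ℝ} (hq : 0 ≤ q) (n : ℕ) (z : ℂ) :
    HasDerivAt (cpowInterpError q n)
      (-(((n + 1 + q : ℝ) : ℂ) ^ (-z) * Real.log (n + 1 + q)) -
        -(((n + 1 : ℝ) : ℂ) ^ (-z) * Real.log (n + 1)) -
        q * (-(((n + 2 : ℝ) : ℂ) ^ (-z) * Real.log (n + 2)) -
          -(((n + 1 : ℝ) : ℂ) ^ (-z) * Real.log (n + 1)))) z :=
  ((hasDerivAt_const_cpow_neg (by positivity) z).sub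
    (hasDerivAt_const_cpow_neg (by positivity) z)).sub
    (((hasDerivAt_const_cpow_neg (by positivity) z).sub
      (hasDerivAt_const_cpow_neg (by positivity) z)).const_mul _)

theorem differentiableOn_tsum_cpowInterpError {q : ℝ} (hq0 : 0 ≤ q) (hq1 : q ≤ 1) :
    DifferentiableOn ℂ (fun z => ∑' n, cpowInterpError q n z) hurwitzRegion :=
  Complex.differentiableOn_tsum_of_summable_norm summable_cpowInterpError_bound
    (fun n z _ => (hasDerivAt_cpowInterpError hq0 n z).differentiableAt.differentiableWithinAt)
    isOpen_hurwitzRegion (fun n _ hz => norm_cpowInterpError_le hq0 hq1 n hz)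

-- For Re z > 1 the pieces sum separately: shifted Hurwitz series, zeta series, and a telescoping
-- sum equal to -1, which contributes +q.
open Complex HurwitzZeta Filter Topology in
theorem hasSum_cpowInterpError {q : ℝ} (hq0 : 0 < q) (hq1 : q ≤ 1) {z : ℂ} (hz : 1 < z.re) :
    HasSum (fun n => cpowInterpError q n z)
      (hurwitzZeta (q : UnitAddCircle) z - riemannZeta z - (q : ℂ) ^ (-z) + q) := by
  have hz0 : z ≠ 0 := fun h => by simp [h] at hz; linarith
  have h1 := hasSum_hurwitzZeta_of_one_lt_re ⟨hq0.le, hq1⟩ hz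
  -- At a = 0 the term n = 0 is `1 / 0 ^ z = 0`, so the later shift by one removes nothing.
  have h2 := hasSum_hurwitzZeta_of_one_lt_re (a := 0) ⟨le_rfl, zero_le_one⟩ hz
  rw [AddCircle.coe_zero, hurwitzZeta_zero] at h2
  rw [← hasSum_nat_add_iff' 1] at h1 h2
  simp only [Finset.sum_range_one, Nat.cast_zero, zero_add, ofReal_zero, add_zero, ne_eq, hz0,
    not_false_eq_true, zero_cpow, div_zero, sub_zero] at h1 h2
  have h3 := (hasSum_nat_add_iff' 1).mpr h2
  have h4 := (h1.sub h2).sub ((h3.sub h2).mul_left (q : ℂ))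
  convert! h4 using 1
  · funext n
    simp only [cpowInterpError, cpow_neg, one_div]
    push_cast
    ring_nf
  · simp only [Finset.sum_range_one, cpow_neg]
    simp
    ring

-- Identity theorem from a neighbourhood of z = 2: the poles at z = 1 cancel in the difference, so
-- both sides are analytic on the region.
open Complex HurwitzZeta Filter Topology in
theorem hurwitzZeta_sub_riemannZeta_eq {q : ℝ} (hq0 : 0 < q) (hq1 : q ≤ 1) {z : ℂ}
    (hz : z ∈ hurwitzRegion) :
    hurwitzZeta (q : UnitAddCircle) z - riemannZeta z =
      (q : ℂ) ^ (-z) - q + ∑' n, cpowInterpError q n z := by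
  have hL : AnalyticOnNhd ℂ (fun z => hurwitzZeta (q : UnitAddCircle) z - riemannZeta z)
      hurwitzRegion := by
    have := differentiable_hurwitzZeta_sub_hurwitzZeta (q : UnitAddCircle) 0
    rw [hurwitzZeta_zero] at this
    exact this.differentiableOn.analyticOnNhd isOpen_hurwitzRegion
  have hR : AnalyticOnNhd ℂ (fun z => (q : ℂ) ^ (-z) - q + ∑' n, cpowInterpError q n z)
      hurwitzRegion := by
    refine DifferentiableOn.analyticOnNhd (DifferentiableOn.add (fun w _ => ?_)
      (differentiableOn_tsum_cpowInterpError hq0.le hq1)) isOpen_hurwitzRegion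
    exact ((hasDerivAt_const_cpow_neg hq0 w).differentiableAt.sub_const _).differentiableWithinAt
  refine hL.eqOn_of_preconnected_of_eventuallyEq hR convex_hurwitzRegion.isPreconnected
    (z₀ := 2) ⟨by simp; norm_num, by simp; norm_num⟩ ?_ hz
  filter_upwards [(isOpen_lt continuous_const continuous_re).mem_nhds
    (show (1 : ℝ) < (2 : ℂ).re by simp)] with w hw
  rw [(hasSum_cpowInterpError hq0 hq1 hw).tsum_eq]
  ring

open Complex HurwitzZeta Filter Topology in
theorem deriv_hurwitzZeta_eq {q : ℝ} (hq0 : 0 < q) (hq1 : q ≤ 1) {z : ℂ}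
    (hz : z ∈ hurwitzRegion) (hz1 : z ≠ 1) :
    deriv (hurwitzZeta (q : UnitAddCircle)) z = deriv riemannZeta z -
      (q : ℂ) ^ (-z) * Real.log q + deriv (fun z => ∑' n, cpowInterpError q n z) z := by
  have h1 := (differentiableAt_riemannZeta hz1).hasDerivAt
  have h2 := hasDerivAt_const_cpow_neg hq0 z
  have h3 := ((differentiableOn_tsum_cpowInterpError hq0.le hq1).differentiableAt
    (isOpen_hurwitzRegion.mem_nhds hz)).hasDerivAt
  have h4 := (h1.add ((h2.sub_const (q : ℂ)).add h3))
  have h5 := h4.congr_of_eventuallyEq (f₁ := hurwitzZeta (q : UnitAddCircle)) (by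
    filter_upwards [isOpen_hurwitzRegion.mem_nhds hz] with w hw
    simp only [Pi.add_apply]
    linear_combination hurwitzZeta_sub_riemannZeta_eq hq0 hq1 hw)
  rw [h5.deriv]
  ring

theorem exists_norm_deriv_tsum_cpowInterpError_le :
    ∃ C : ℝ, ∀ q : ℝ, 0 ≤ q → q ≤ 1 → ∀ z : ℂ, ‖z‖ < 1 / 4 →
      ‖deriv (fun z => ∑' n, cpowInterpError q n z) z‖ ≤ C := by
  -- Cauchy's estimate on a circle of radius 1/4, which stays in Re w > -1/2 when |z| < 1/4.
  refine ⟨(∑' n : ℕ, 12 * ((n + 1 : ℕ) : ℝ) ^ (-(3 / 2) : ℝ)) / (1 / 4), fun q hq0 hq1 z hz => ?_⟩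
  have hsub : Metric.closedBall z (1 / 4) ⊆ hurwitzRegion := by
    intro w hw
    rw [mem_closedBall_iff_norm] at hw
    have h1 : ‖w‖ < 1 / 2 := by
      calc ‖w‖ = ‖z + (w - z)‖ := by ring_nf
        _ ≤ ‖z‖ + ‖w - z‖ := norm_add_le _ _
        _ < 1 / 2 := by linarith
    refine ⟨?_, mem_ball_zero_iff.mpr (by linarith)⟩
    have := (abs_le.mp (Complex.abs_re_le_norm w)).1
    change -(1 / 2) < w.re
    linarith
  refine Complex.norm_deriv_le_of_forall_mem_sphere_norm_le (by norm_num)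
    (((differentiableOn_tsum_cpowInterpError hq0 hq1).mono hsub).diffContOnCl_ball subset_rfl)
    fun w hw => ?_
  exact tsum_of_norm_bounded summable_cpowInterpError_bound.hasSum fun n =>
    norm_cpowInterpError_le hq0 hq1 n (hsub (Metric.sphere_subset_closedBall hw))

open Complex HurwitzZeta Filter Topology in
/-- Lerch's formula `∂_zζ(z, q) = log Γ(q) - log √(2π)` at `z = 0`. -/
theorem deriv_hurwitzZeta_zero {q : ℝ} (hq0 : 0 < q) (hq1 : q ≤ 1) :
    deriv (hurwitzZeta (q : UnitAddCircle)) 0 =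
      ((Real.log (Real.Gamma q) - Real.log (2 * Real.pi) / 2 : ℝ) : ℂ) := by
  have h0 : (0 : ℂ) ∈ hurwitzRegion := ⟨by simp, by simp⟩
  have hs := Complex.hasSum_deriv_of_summable_norm summable_cpowInterpError_bound
    (fun n z _ => (hasDerivAt_cpowInterpError hq0.le n z).differentiableAt.differentiableWithinAt)
    isOpen_hurwitzRegion (fun n _ hz => norm_cpowInterpError_le hq0.le hq1 n hz) h0
  have hterm : ∀ n, deriv (cpowInterpError q n) 0 = ((Real.log (n + 1) - Real.log (q + (n + 1)) +
      q * (Real.log (n + 2) - Real.log (n + 1)) : ℝ) : ℂ) := fun n => by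
    rw [(hasDerivAt_cpowInterpError hq0.le n 0).deriv, neg_zero, cpow_zero, cpow_zero, cpow_zero,
      add_comm q]
    push_cast
    ring
  -- The partial sums are Euler's sequence for ln Γ(q), up to its missing factor at index 0 (the ln
  -- q) and ln(N+1) in place of ln N.
  have hpart : ∀ N : ℕ, ∑ n ∈ Finset.range N, (Real.log (n + 1) - Real.log (q + (n + 1)) +
      q * (Real.log (n + 2) - Real.log (n + 1))) =
      Real.BohrMollerup.logGammaSeq q N + Real.log q + q * (Real.log (N + 1) - Real.log N) := by
    intro N
    have a1 : ∑ n ∈ Finset.range N, Real.log (n + 1) = Real.log (N.factorial : ℝ) := by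
      rw [← Finset.prod_range_add_one_eq_factorial, Nat.cast_prod, Real.log_prod]
      · simp
      · intro i _; positivity
    have a2 : ∑ n ∈ Finset.range N, (Real.log (n + 2) - Real.log (n + 1)) = Real.log (N + 1) := by
      have := Finset.sum_range_sub (fun n : ℕ => Real.log (n + 1)) N
      simp only [Nat.cast_add, Nat.cast_one, add_assoc, one_add_one_eq_two, Nat.cast_zero,
        zero_add, Real.log_one, sub_zero] at this
      exact this
    rw [Finset.sum_add_distrib, Finset.sum_sub_distrib, ← Finset.mul_sum, a1, a2,
      Real.BohrMollerup.logGammaSeq, Finset.sum_range_succ']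
    push_cast
    rw [add_zero]
    ring
  have hlim : Tendsto (fun N : ℕ => ∑ n ∈ Finset.range N, (Real.log (n + 1) -
      Real.log (q + (n + 1)) + q * (Real.log (n + 2) - Real.log (n + 1)))) atTop
      (𝓝 (Real.log (Real.Gamma q) + Real.log q)) := by
    simp only [hpart]
    have := ((Real.BohrMollerup.tendsto_log_gamma hq0).add_const (Real.log q)).add
      (Real.tendsto_log_nat_add_one_sub_log.const_mul q)
    simpa using this
  have hval := hs.tendsto_sum_nat
  simp only [hterm, ← ofReal_sum] at hval
  have := tendsto_nhds_unique hval ((continuous_ofReal.tendsto _).comp hlim)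
  rw [deriv_hurwitzZeta_eq hq0 hq1 h0 zero_ne_one, this, deriv_riemannZeta_zero, neg_zero,
    cpow_zero]
  have hlog : log (2 * (Real.pi : ℂ)) = (Real.log (2 * Real.pi) : ℂ) := by
    rw [ofReal_log (by positivity)]
    push_cast
    rfl
  rw [hlog]
  push_cast
  ring

/-! ### Square integrability and domination near the critical case. -/

open MeasureTheory in
theorem memLp_two_log : MemLp Real.log 2 (volume.restrict (Set.Ioc 0 1)) := by
  refine (memLp_two_iff_integrable_sq Real.measurable_log.aestronglyMeasurable).mpr ?_
  have hint : IntegrableOn (fun q : ℝ => 16 * q ^ (-(1 / 2) : ℝ)) (Set.Ioc 0 1) :=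
    ((intervalIntegrable_iff_integrableOn_Ioc_of_le zero_le_one).mp
      (intervalIntegral.intervalIntegrable_rpow' (by norm_num))).const_mul 16
  refine hint.mono' (Real.measurable_log.pow_const 2).aestronglyMeasurable ?_
  refine (ae_restrict_iff' measurableSet_Ioc).mpr (Filter.Eventually.of_forall fun q hq => ?_)
  -- Exponent 1/4 gives |ln q| q^{1/4} ≤ 4, so ln² q ≤ 16 q^{-1/2}, which is integrable.
  have h := (Real.abs_log_mul_self_rpow_lt q (1 / 4) hq.1 hq.2 (by norm_num)).le
  have hq4 : 0 < q ^ (1 / 4 : ℝ) := Real.rpow_pos_of_pos hq.1 _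
  have e : q ^ (-(1 / 2) : ℝ) = (q ^ (1 / 4 : ℝ) * q ^ (1 / 4 : ℝ))⁻¹ := by
    rw [← Real.rpow_add hq.1, ← Real.rpow_neg hq.1.le]
    norm_num
  rw [Real.norm_eq_abs, abs_of_nonneg (sq_nonneg _), e, ← div_eq_mul_inv,
    le_div_iff₀ (by positivity)]
  have h2 : (Real.log q * q ^ (1 / 4 : ℝ)) ^ 2 ≤ 4 ^ 2 :=
    sq_le_sq' (by linarith [(abs_le.mp h).1]) (by linarith [(abs_le.mp h).2])
  nlinarith

-- Only q^{-z} ln q is unbounded as q → 0, and Re z ≤ 0 gives |q^{-z}| ≤ 1. The bound is uniform in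
-- z, so it serves both for z = 0 and for the limit z → 0 from the left.
open MeasureTheory HurwitzZeta in
theorem exists_norm_deriv_hurwitzZeta_le :
    ∃ C : ℝ, ∀ᶠ z : ℂ in nhds 0, z.re ≤ 0 → ∀ q : ℝ, q ∈ Set.Ioc (0 : ℝ) 1 →
      ‖deriv (hurwitzZeta (q : UnitAddCircle)) z‖ ≤ C + |Real.log q| := by
  obtain ⟨C, hC⟩ := exists_norm_deriv_tsum_cpowInterpError_le
  have hd : DifferentiableOn ℂ riemannZeta {1}ᶜ := fun z hz =>
    (differentiableAt_riemannZeta hz).differentiableWithinAt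
  have hc : ContinuousAt (deriv riemannZeta) 0 :=
    ((hd.deriv isOpen_compl_singleton).differentiableAt
      (isOpen_compl_singleton.mem_nhds (by simp))).continuousAt
  refine ⟨‖deriv riemannZeta 0‖ + 1 + C, ?_⟩
  filter_upwards [hc.norm.eventually_lt_const (lt_add_one ‖deriv riemannZeta 0‖),
    Metric.ball_mem_nhds (0 : ℂ) (show (0 : ℝ) < 1 / 4 by norm_num),
    isOpen_hurwitzRegion.mem_nhds (show (0 : ℂ) ∈ hurwitzRegion from ⟨by simp, by simp⟩)]
    with z h1 h2 h3 hre q hq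
  rw [mem_ball_zero_iff] at h2
  have hz1 : z ≠ 1 := by
    rintro rfl
    simp at hre
    linarith
  have h4 : ‖(q : ℂ) ^ (-z) * (Real.log q : ℂ)‖ ≤ |Real.log q| := by
    rw [norm_mul, Complex.norm_cpow_eq_rpow_re_of_pos hq.1, Complex.norm_real, Real.norm_eq_abs]
    refine mul_le_of_le_one_left (abs_nonneg _) (Real.rpow_le_one hq.1.le hq.2 ?_)
    simpa using hre
  rw [deriv_hurwitzZeta_eq hq.1 hq.2 h3 hz1]
  calc _ ≤ ‖deriv riemannZeta z‖ + ‖(q : ℂ) ^ (-z) * (Real.log q : ℂ)‖ +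
        ‖deriv (fun z => ∑' n, cpowInterpError q n z) z‖ :=
        (norm_add_le _ _).trans (by gcongr; exact norm_sub_le _ _)
    _ ≤ _ := by linarith [hC q hq.1.le hq.2 z h2]

open MeasureTheory HurwitzZeta in
theorem continuousAt_deriv_hurwitzZeta (a : UnitAddCircle) {z : ℂ} (hz : z ≠ 1) :
    ContinuousAt (deriv (hurwitzZeta a)) z := by
  have hd : DifferentiableOn ℂ (hurwitzZeta a) {1}ᶜ := fun z hz =>
    (differentiableAt_hurwitzZeta a hz).differentiableWithinAt
  exact ((hd.deriv isOpen_compl_singleton).differentiableAt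
    (isOpen_compl_singleton.mem_nhds hz)).continuousAt

open MeasureTheory HurwitzZeta in
theorem memLp_deriv_hurwitzZeta_zero :
    MemLp (fun q : ℝ => deriv (hurwitzZeta (q : UnitAddCircle)) 0) 2
      (volume.restrict (Set.Ioc 0 1)) := by
  obtain ⟨C, hC⟩ := exists_norm_deriv_hurwitzZeta_le
  have hG : ContinuousOn (fun q : ℝ => ((Real.log (Real.Gamma q) - Real.log (2 * Real.pi) / 2 : ℝ)
      : ℂ)) (Set.Ioc 0 1) := by
    refine Complex.continuous_ofReal.comp_continuousOn (ContinuousOn.sub ?_ continuousOn_const)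
    refine ContinuousOn.log (fun q hq => ?_) fun q hq => (Real.Gamma_pos_of_pos hq.1).ne'
    refine (Real.differentiableAt_Gamma fun m h => ?_).continuousAt.continuousWithinAt
    have : (0 : ℝ) ≤ m := Nat.cast_nonneg m
    linarith [hq.1]
  have hm : AEStronglyMeasurable (fun q : ℝ => deriv (hurwitzZeta (q : UnitAddCircle)) 0)
      (volume.restrict (Set.Ioc 0 1)) :=
    (hG.aestronglyMeasurable measurableSet_Ioc).congr
      ((ae_restrict_iff' measurableSet_Ioc).mpr (Filter.Eventually.of_forall fun q hq =>
        (deriv_hurwitzZeta_zero hq.1 hq.2).symm))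
  have hbd : MemLp (fun q : ℝ => C + |Real.log q|) 2 (volume.restrict (Set.Ioc 0 1)) :=
    (memLp_const C).add memLp_two_log.norm
  refine hbd.mono hm ((ae_restrict_iff' measurableSet_Ioc).mpr
    (Filter.Eventually.of_forall fun q hq => ?_))
  exact (hC.self_of_nhds (by simp) q hq).trans (le_abs_self _)

/-! ### The critical case s = 1 as a limit. -/

open MeasureTheory HurwitzZeta Filter Topology in
theorem tendsto_fourierCoeffOn_deriv_hurwitzZeta (m : ℤ) :
    Tendsto (fun t : ℝ => fourierCoeffOn (zero_lt_one' ℝ)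
        (fun q : ℝ => deriv (hurwitzZeta (q : UnitAddCircle)) (1 - (1 + t))) m) (𝓝[>] 0)
      (𝓝 (fourierCoeffOn (zero_lt_one' ℝ)
        (fun q : ℝ => deriv (hurwitzZeta (q : UnitAddCircle)) 0) m)) := by
  obtain ⟨C, hC⟩ := exists_norm_deriv_hurwitzZeta_le
  simp only [fourierCoeffOn_zero_one_eq]
  have hlim : Tendsto (fun t : ℝ => (1 - (1 + t) : ℂ)) (𝓝[>] 0) (𝓝 0) := by
    have : Continuous fun t : ℝ => (1 - (1 + t) : ℂ) := by fun_prop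
    exact (this.tendsto' 0 0 (by simp)).mono_left nhdsWithin_le_nhds
  refine intervalIntegral.tendsto_integral_filter_of_dominated_convergence
    (fun q => C + |Real.log q|) ?_ ?_ ?_ ?_
  · filter_upwards [self_mem_nhdsWithin] with t ht
    have hs : 1 < (1 + t : ℂ).re := by simpa using ht
    exact (((map_continuous (fourier (-m))).mul
      (fourierCoeff_deriv_hurwitzZeta hs).1).comp (AddCircle.continuous_mk' 1)).aestronglyMeasurable
  · filter_upwards [self_mem_nhdsWithin, hlim.eventually hC] with t ht h
    refine Eventually.of_forall fun q hq => ?_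
    rw [Set.uIoc_of_le zero_le_one] at hq
    rw [norm_mul, fourier_apply, Circle.norm_coe, one_mul]
    refine h ?_ q hq
    have : 0 < t := ht
    simp [this.le]
  · exact (intervalIntegrable_const (μ := volume)).add
      intervalIntegral.intervalIntegrable_log'.norm
  · refine Eventually.of_forall fun q _ => Tendsto.const_mul _ ?_
    exact (continuousAt_deriv_hurwitzZeta (q : UnitAddCircle) zero_ne_one).tendsto.comp hlim

-- The terms are now of size ln n / n, so the coefficients are obtained as limits from s = 1 + t, t
-- > 0, on both sides of the known formula.
open MeasureTheory HurwitzZeta Filter Topology in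
theorem fourierCoeffOn_deriv_hurwitzZeta_zero (n : ℕ) :
    fourierCoeffOn (zero_lt_one' ℝ)
        (fun q : ℝ => deriv (hurwitzZeta (q : UnitAddCircle)) 0) n = hurwitzDerivCoeff (-1) 1 n ∧
    fourierCoeffOn (zero_lt_one' ℝ)
        (fun q : ℝ => deriv (hurwitzZeta (q : UnitAddCircle)) 0) (-n) =
      hurwitzDerivCoeff 1 1 n := by
  have hlim : Tendsto (fun t : ℝ => (1 + t : ℂ)) (𝓝[>] 0) (𝓝 1) := by
    have : Continuous fun t : ℝ => (1 + t : ℂ) := by fun_prop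
    exact (this.tendsto' 0 1 (by simp)).mono_left nhdsWithin_le_nhds
  have hcoef : ∀ ε, Tendsto (fun t : ℝ => hurwitzDerivCoeff ε (1 + t) n) (𝓝[>] 0)
      (𝓝 (hurwitzDerivCoeff ε 1 n)) := fun ε =>
    (continuousAt_hurwitzDerivCoeff ε n (s := 1) (by simp)).tendsto.comp hlim
  constructor
  · refine tendsto_nhds_unique (tendsto_fourierCoeffOn_deriv_hurwitzZeta n) ((hcoef _).congr' ?_)
    filter_upwards [self_mem_nhdsWithin] with t ht
    have hs : 1 < (1 + t : ℂ).re := by simpa using ht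
    rw [← ((fourierCoeff_deriv_hurwitzZeta hs).2 n).1, ← fourierCoeffOn_zero_one_eq_fourierCoeff]
  · refine tendsto_nhds_unique (tendsto_fourierCoeffOn_deriv_hurwitzZeta _) ((hcoef _).congr' ?_)
    filter_upwards [self_mem_nhdsWithin] with t ht
    have hs : 1 < (1 + t : ℂ).re := by simpa using ht
    rw [← ((fourierCoeff_deriv_hurwitzZeta hs).2 n).2, ← fourierCoeffOn_zero_one_eq_fourierCoeff]

open MeasureTheory HurwitzZeta in
theorem memLp_deriv_hurwitzZeta_one_sub {k : ℕ} (hk : 1 ≤ k) :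
    MemLp (fun q : ℝ => deriv (hurwitzZeta (q : UnitAddCircle)) (1 - (k : ℂ))) 2
      (volume.restrict (Set.Ioc 0 1)) := by
  rcases hk.eq_or_lt with rfl | hk
  · simpa using memLp_deriv_hurwitzZeta_zero
  · have hs : 1 < (k : ℂ).re := by simpa using hk
    have hc : Continuous fun q : ℝ => deriv (hurwitzZeta (q : UnitAddCircle)) (1 - (k : ℂ)) :=
      (fourierCoeff_deriv_hurwitzZeta hs).1.comp (AddCircle.continuous_mk' 1)
    obtain ⟨C, hC⟩ := isCompact_Icc.exists_bound_of_continuousOn (s := Set.Icc (0 : ℝ) 1)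
      hc.continuousOn
    exact MemLp.of_bound hc.aestronglyMeasurable C ((ae_restrict_iff' measurableSet_Ioc).mpr
      (Filter.Eventually.of_forall fun q hq => hC q (Set.Ioc_subset_Icc_self hq)))

open MeasureTheory HurwitzZeta in
theorem fourierCoeffOn_deriv_hurwitzZeta_one_sub {k : ℕ} (hk : 1 ≤ k) (n : ℕ) :
    fourierCoeffOn (zero_lt_one' ℝ)
        (fun q : ℝ => deriv (hurwitzZeta (q : UnitAddCircle)) (1 - (k : ℂ))) n =
      hurwitzDerivCoeff (-1) k n ∧
    fourierCoeffOn (zero_lt_one' ℝ)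
        (fun q : ℝ => deriv (hurwitzZeta (q : UnitAddCircle)) (1 - (k : ℂ))) (-n) =
      hurwitzDerivCoeff 1 k n := by
  rcases hk.eq_or_lt with rfl | hk
  · simpa using fourierCoeffOn_deriv_hurwitzZeta_zero n
  · have hs : 1 < (k : ℂ).re := by simpa using hk
    have := (fourierCoeff_deriv_hurwitzZeta hs).2 n
    rwa [← fourierCoeffOn_zero_one_eq_fourierCoeff, ← fourierCoeffOn_zero_one_eq_fourierCoeff]
      at this

/-! ### Fourier coefficients of the negapolygamma functions. -/

theorem negapolygamma_eq (k : ℕ) {q : ℝ} (hq : q ≤ 1) :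
    negapolygamma k q = (k / k.factorial : ℂ) *
      deriv (HurwitzZeta.hurwitzZeta (q : UnitAddCircle)) (1 - (k : ℂ)) +
      -((harmonic (k - 1) : ℂ) / k.factorial) * (bernoulliFun k q : ℂ) := by
  have hB : Polynomial.aeval (q : ℂ) (Polynomial.bernoulli k) = (bernoulliFun k q : ℂ) := by
    rw [bernoulliFun, Polynomial.eval_map_algebraMap]
    exact Polynomial.aeval_algebraMap_apply ℂ q _
  have hd : (fun z : ℂ => hurwitzZetaFn z q) = HurwitzZeta.hurwitzZeta (q : UnitAddCircle) :=
    funext fun z => hurwitzZetaFn_of_le_one z hq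
  rw [negapolygamma, hurwitzA, hB, hd]
  ring

theorem continuous_ofReal_bernoulliFun (k : ℕ) : Continuous fun q : ℝ => (bernoulliFun k q : ℂ) :=
  Complex.continuous_ofReal.comp (Polynomial.continuous _)

open MeasureTheory in
theorem negapolygamma_ae_eq (k : ℕ) : negapolygamma k =ᵐ[volume.restrict (Set.Ioc 0 1)]
    fun q : ℝ => (k / k.factorial : ℂ) *
      deriv (HurwitzZeta.hurwitzZeta (q : UnitAddCircle)) (1 - (k : ℂ)) +
      -((harmonic (k - 1) : ℂ) / k.factorial) * (bernoulliFun k q : ℂ) :=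
  (ae_restrict_iff' measurableSet_Ioc).mpr
    (Filter.Eventually.of_forall fun _ hq => negapolygamma_eq k hq.2)

open MeasureTheory in
theorem memLp_negapolygamma {k : ℕ} (hk : 1 ≤ k) :
    MemLp (negapolygamma k) 2 (volume.restrict (Set.Ioc 0 1)) := by
  refine MemLp.ae_eq (negapolygamma_ae_eq k).symm
    (((memLp_deriv_hurwitzZeta_one_sub hk).const_mul _).add (MemLp.const_mul ?_ _))
  obtain ⟨C, hC⟩ := isCompact_Icc.exists_bound_of_continuousOn (s := Set.Icc (0 : ℝ) 1)
    (continuous_ofReal_bernoulliFun k).continuousOn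
  exact MemLp.of_bound (continuous_ofReal_bernoulliFun k).aestronglyMeasurable C
    ((ae_restrict_iff' measurableSet_Ioc).mpr
      (Filter.Eventually.of_forall fun q hq => hC q (Set.Ioc_subset_Icc_self hq)))

-- B_k has coefficient -k!/(2πim)^k. At m = 0 division by zero gives 0, which is the correct mean as
-- k ≥ 1.
open MeasureTheory in
theorem fourierCoeffOn_negapolygamma_eq {k : ℕ} (hk : 1 ≤ k) (m : ℤ) :
    fourierCoeffOn (zero_lt_one' ℝ) (negapolygamma k) m =
      (k / k.factorial : ℂ) * fourierCoeffOn (zero_lt_one' ℝ) (fun q : ℝ =>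
        deriv (HurwitzZeta.hurwitzZeta (q : UnitAddCircle)) (1 - (k : ℂ))) m +
      (harmonic (k - 1) : ℂ) / (2 * Real.pi * Complex.I * m) ^ k := by
  have h1 : IntervalIntegrable (fun q : ℝ =>
      deriv (HurwitzZeta.hurwitzZeta (q : UnitAddCircle)) (1 - (k : ℂ))) volume 0 1 :=
    (intervalIntegrable_iff_integrableOn_Ioc_of_le zero_le_one).mpr
      ((memLp_deriv_hurwitzZeta_one_sub hk).integrable one_le_two)
  have hf : (k.factorial : ℂ) ≠ 0 := by exact_mod_cast k.factorial_ne_zero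
  have hb := bernoulliFourierCoeff_eq (k := k) (by omega) m
  rw [bernoulliFourierCoeff] at hb
  rw [fourierCoeffOn_congr_ae _ (negapolygamma_ae_eq k), fourierCoeffOn_zero_one_add
    (h1.const_mul _) (((continuous_ofReal_bernoulliFun k).intervalIntegrable _ _).const_mul _),
    fourierCoeffOn.const_mul, fourierCoeffOn.const_mul, hb]
  field_simp

-- Γ'(k) = (k-1)!(-γ + H_{k-1}) and e^{επik/2} = (εi)^k; since (εi)(-εi) = 1, this power moves into
-- the denominator as (-εi)^k.
open Complex in
theorem hurwitzDerivCoeff_natCast {ε : ℂ} (hε : ε = 1 ∨ ε = -1) {k : ℕ} (hk : 1 ≤ k) (n : ℕ) :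
    hurwitzDerivCoeff ε k n = (k - 1).factorial *
      (Real.eulerMascheroniConstant + Real.log (2 * Real.pi) + Real.log n - harmonic (k - 1) -
        ε * (Real.pi * I / 2)) / (2 * Real.pi * I * (-ε * n)) ^ k := by
  obtain ⟨j, rfl⟩ : ∃ j, k = j + 1 := ⟨k - 1, by omega⟩
  have hε1 : ε * ε = 1 := by rcases hε with rfl | rfl <;> ring
  have hre : 0 < ((j + 1 : ℕ) : ℂ).re := by simp; positivity
  have hexp : exp (ε * (Real.pi * I * ((j + 1 : ℕ) : ℂ) / 2)) = (ε * I) ^ (j + 1) := by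
    rw [show ε * (Real.pi * I * ((j + 1 : ℕ) : ℂ) / 2) =
      ((j + 1 : ℕ) : ℂ) * (ε * (Real.pi / 2 * I)) by ring, exp_nat_mul]
    congr 1
    rcases hε with rfl | rfl
    · rw [one_mul, exp_pi_div_two_mul_I, one_mul]
    · rw [neg_one_mul, exp_neg, exp_pi_div_two_mul_I, inv_I, neg_one_mul]
  have hlog : log (2 * (Real.pi : ℂ)) = (Real.log (2 * Real.pi) : ℂ) := by
    rw [ofReal_log (by positivity)]
    push_cast
    rfl
  have hG : Gamma ((j + 1 : ℕ) : ℂ) = j.factorial := by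
    push_cast
    exact Gamma_nat_eq_factorial j
  have hG' : deriv Gamma ((j + 1 : ℕ) : ℂ) =
      j.factorial * (-Real.eulerMascheroniConstant + harmonic j) := by
    push_cast
    exact deriv_Gamma_nat j
  have hden : (2 * Real.pi * I * (-ε * n)) ^ (j + 1) * (ε * I) ^ (j + 1) =
      ((2 * Real.pi) ^ (j + 1) * n ^ (j + 1) : ℂ) := by
    rw [← mul_pow, ← mul_pow]
    congr 1
    linear_combination (-2 * (Real.pi : ℂ) * n * ε * ε) * I_sq + 2 * Real.pi * n * hε1
  rw [hurwitzDerivCoeff, (hasDerivAt_hurwitzFactor ε hre).deriv, hurwitzFactor, hexp, hlog, hG, hG',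
    cpow_neg, cpow_neg, cpow_natCast, cpow_natCast, ← natCast_log]
  rcases Nat.eq_zero_or_pos n with rfl | hn
  · simp
  have hn0 : (n : ℂ) ≠ 0 := by exact_mod_cast hn.ne'
  have hε0 : ε ≠ 0 := by rintro rfl; simp at hε1
  have hpi : (Real.pi : ℂ) ≠ 0 := by exact_mod_cast Real.pi_ne_zero
  have hd0 : (2 * Real.pi * I * (-ε * n)) ^ (j + 1) ≠ 0 :=
    pow_ne_zero _ (by simp [hpi, hε0, hn0])
  have hp0 : ((2 * Real.pi) ^ (j + 1) * n ^ (j + 1) : ℂ) ≠ 0 := by simp [hpi, hn0]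
  rw [Nat.add_sub_cancel, eq_div_iff hd0]
  have hinv : (((2 * Real.pi : ℂ) ^ (j + 1))⁻¹ * ((n : ℂ) ^ (j + 1))⁻¹) *
      ((2 * Real.pi) ^ (j + 1) * n ^ (j + 1)) = 1 := by
    rw [← mul_inv, inv_mul_cancel₀ hp0]
  rw [← hden] at hinv
  linear_combination (j.factorial * (Real.eulerMascheroniConstant + Real.log (2 * Real.pi) +
    Real.log n - harmonic j - ε * (Real.pi * I / 2)) : ℂ) * hinv

-- The two harmonic-number terms cancel, which is what makes the functions balanced. At n = 0 the
-- formula reads 0 and records the vanishing mean.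
open Complex in
theorem fourierCoeffOn_negapolygamma {k : ℕ} (hk : 1 ≤ k) (n : ℕ) :
    fourierCoeffOn (zero_lt_one' ℝ) (negapolygamma k) n =
      (Real.eulerMascheroniConstant + Real.log (2 * Real.pi) + Real.log n + Real.pi * I / 2) /
        (2 * Real.pi * I * n) ^ k ∧
    fourierCoeffOn (zero_lt_one' ℝ) (negapolygamma k) (-n) =
      (Real.eulerMascheroniConstant + Real.log (2 * Real.pi) + Real.log n - Real.pi * I / 2) /
        (2 * Real.pi * I * (-n)) ^ k := by
  obtain ⟨h1, h2⟩ := fourierCoeffOn_deriv_hurwitzZeta_one_sub hk n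
  have hf : ((k : ℂ) / k.factorial) * ((k - 1).factorial : ℂ) = 1 := by
    have h : (k : ℂ) * ((k - 1).factorial : ℂ) = k.factorial := by
      exact_mod_cast Nat.mul_factorial_pred (by omega)
    rw [div_mul_eq_mul_div, h, div_self (by exact_mod_cast k.factorial_ne_zero)]
  constructor
  · rw [fourierCoeffOn_negapolygamma_eq hk, h1, hurwitzDerivCoeff_natCast (Or.inr rfl) hk,
      mul_div_assoc, ← mul_assoc, hf, Int.cast_natCast, neg_neg, one_mul (n : ℂ)]
    ring
  · rw [fourierCoeffOn_negapolygamma_eq hk, h2, hurwitzDerivCoeff_natCast (Or.inl rfl) hk,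
      mul_div_assoc, ← mul_assoc, hf, Int.cast_neg, Int.cast_natCast, neg_one_mul (n : ℂ)]
    ring

/-! ### Summation of the Parseval series. -/

open Complex in
theorem inv_I_pow_mul_inv_neg_I_pow_add (k k' : ℕ) :
    (((-I) ^ k * I ^ k')⁻¹ + (I ^ k * (-I) ^ k')⁻¹ : ℂ) =
      2 * (Real.cos (((k : ℝ) - (k' : ℝ)) * (Real.pi / 2)) : ℂ) := by
  have hI : ∀ j : ℕ, I ^ j = exp (j * (Real.pi / 2 * I)) := fun j => by
    rw [exp_nat_mul, exp_pi_div_two_mul_I]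
  have hI' : ∀ j : ℕ, (-I) ^ j = exp (-(j * (Real.pi / 2 * I))) := fun j => by
    rw [← mul_neg, exp_nat_mul, exp_neg, exp_pi_div_two_mul_I, inv_I]
  rw [hI, hI', hI, hI', ← exp_add, ← exp_add, ← exp_neg, ← exp_neg, ofReal_cos, cos]
  push_cast
  rw [mul_div_cancel₀ _ two_ne_zero]
  congr 2 <;> ring

-- Each factor ln n is minus a derivative of ∑ n^{-s}; expanding the square leaves ζ'', ζ' and ζ.
-- The term n = 0 is a division by zero, hence 0.
open Complex LSeries in
theorem hasSum_riemannZeta_log_sq {m : ℕ} (hm : 1 < m) (c d : ℂ) :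
    HasSum (fun n : ℕ => ((c + Real.log n) ^ 2 + d) / (n : ℂ) ^ m)
      (iteratedDeriv 2 riemannZeta m - 2 * c * deriv riemannZeta m +
        (c ^ 2 + d) * riemannZeta m) := by
  have hs : 1 < (m : ℂ).re := by simpa using hm
  have hm0 : (m : ℂ) ≠ 0 := by
    have : m ≠ 0 := by omega
    exact_mod_cast this
  have habs : abscissaOfAbsConv 1 < (m : ℂ).re := by
    rw [abscissaOfAbsConv_one]
    exact_mod_cast hs
  have habs' : abscissaOfAbsConv (logMul 1) < (m : ℂ).re := by rwa [abscissaOfAbsConv_logMul]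
  have heq : riemannZeta =ᶠ[nhds (m : ℂ)] LSeries 1 := by
    filter_upwards [(isOpen_lt continuous_const continuous_re).mem_nhds hs] with w hw
    exact (LSeries_one_eq_riemannZeta hw).symm
  have h0 : HasSum (term 1 m) (LSeries 1 m) :=
    (LSeriesSummable_of_abscissaOfAbsConv_lt_re habs).LSeriesHasSum
  have h1 : HasSum (term (logMul 1) m) (LSeries (logMul 1) m) :=
    (LSeriesSummable_logMul_of_lt_re habs).LSeriesHasSum
  have h2 : HasSum (term (logMul (logMul 1)) m) (LSeries (logMul (logMul 1)) m) :=
    (LSeriesSummable_logMul_of_lt_re habs').LSeriesHasSum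
  have e2 : iteratedDeriv 2 (LSeries 1) (m : ℂ) = (-1) ^ 2 * LSeries (logMul (logMul 1)) m :=
    LSeries_iteratedDeriv 2 habs
  rw [heq.iteratedDeriv_eq, heq.deriv_eq, heq.eq_of_nhds, e2, LSeries_deriv habs]
  have h := (h2.add (h1.mul_left (2 * c))).add (h0.mul_left (c ^ 2 + d))
  have hterm : ∀ n : ℕ, term (logMul (logMul 1)) m n + 2 * c * term (logMul 1) m n +
      (c ^ 2 + d) * term 1 m n = ((c + Real.log n) ^ 2 + d) / (n : ℂ) ^ m := fun n => by
    simp only [term_of_ne_zero' hm0, logMul, cpow_natCast, Pi.one_apply, natCast_log]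
    ring
  simp only [hterm] at h
  rw [show ∀ x y w : ℂ, (-1) ^ 2 * x - 2 * c * -y + (c ^ 2 + d) * w =
    x + 2 * c * y + (c ^ 2 + d) * w by intros; ring]
  exact h

open Complex MeasureTheory in
theorem integral_negapolygamma_mul {k k' : ℕ} (hk : 1 ≤ k) (hk' : 1 ≤ k') :
    ∫ q in (0 : ℝ)..1, negapolygamma k q * negapolygamma k' q =
        2 * (Real.cos (((k : ℝ) - (k' : ℝ)) * (Real.pi / 2)) : ℂ) /
            (2 * (Real.pi : ℂ)) ^ (k + k') *
          (iteratedDeriv 2 riemannZeta ((k : ℂ) + (k' : ℂ))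
            - 2 * ((Real.eulerMascheroniConstant : ℂ) + (Real.log (2 * Real.pi) : ℂ)) *
                deriv riemannZeta ((k : ℂ) + (k' : ℂ))
            + (((Real.eulerMascheroniConstant : ℂ) + (Real.log (2 * Real.pi) : ℂ)) ^ 2
                + (Real.pi : ℂ) ^ 2 / 4) * riemannZeta ((k : ℂ) + (k' : ℂ))) := by
  -- Folding the sum over ℤ onto ℕ counts index 0 twice and so adds the zeroth term to the sum; `h0`
  -- makes it vanish.
  have hP := (hasSum_fourierCoeffOn_mul (memLp_negapolygamma hk)
    (memLp_negapolygamma hk')).nat_add_neg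
  have hz := (hasSum_riemannZeta_log_sq (m := k + k') (by omega)
    (Real.eulerMascheroniConstant + Real.log (2 * Real.pi)) (Real.pi ^ 2 / 4)).mul_left
      (2 * (Real.cos (((k : ℝ) - (k' : ℝ)) * (Real.pi / 2)) : ℂ) / (2 * (Real.pi : ℂ)) ^ (k + k'))
  have h0 : fourierCoeffOn (zero_lt_one' ℝ) (negapolygamma k') 0 = 0 := by
    have := (fourierCoeffOn_negapolygamma hk' 0).1
    have hk0 : k' ≠ 0 := by omega
    simpa [hk0] using this
  rw [h0, mul_zero, add_zero] at hP
  rw [← Nat.cast_add]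
  refine hP.unique ?_
  convert! hz using 1
  funext n
  rw [neg_neg, (fourierCoeffOn_negapolygamma hk n).1, (fourierCoeffOn_negapolygamma hk n).2,
    (fourierCoeffOn_negapolygamma hk' n).1, (fourierCoeffOn_negapolygamma hk' n).2,
    ← inv_I_pow_mul_inv_neg_I_pow_add,
    show (2 * Real.pi * I * (-n) : ℂ) = 2 * Real.pi * n * (-I) by ring,
    show (2 * Real.pi * I * n : ℂ) = 2 * Real.pi * n * I by ring]
  simp only [mul_pow, pow_add, div_eq_mul_inv, mul_inv]
  generalize ((I : ℂ) ^ k)⁻¹ = a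
  generalize ((I : ℂ) ^ k')⁻¹ = b
  generalize ((-I : ℂ) ^ k)⁻¹ = a'
  generalize ((-I : ℂ) ^ k')⁻¹ = b'
  -- What remains is (L + πi/2)(L - πi/2) = L² + π²/4, that is, `I_sq`.
  linear_combination (-((2 ^ k)⁻¹ * ((Real.pi : ℂ) ^ k)⁻¹ * ((n : ℂ) ^ k)⁻¹ * ((2 ^ k')⁻¹ *
    ((Real.pi : ℂ) ^ k')⁻¹ * ((n : ℂ) ^ k')⁻¹) * (a' * b + a * b') * Real.pi ^ 2 / 4)) * I_sq

/-! ### The integral of the squared log-gamma function. -/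

theorem negapolygamma_one {q : ℝ} (hq0 : 0 < q) (hq1 : q ≤ 1) :
    negapolygamma 1 q = ((Real.log (Real.Gamma q) - Real.log (2 * Real.pi) / 2 : ℝ) : ℂ) := by
  rw [negapolygamma_eq 1 hq1, ← deriv_hurwitzZeta_zero hq0 hq1]
  simp

theorem integral_negapolygamma_one : ∫ q in (0 : ℝ)..1, negapolygamma 1 q = 0 := by
  have h := (fourierCoeffOn_negapolygamma le_rfl 0).1
  rw [fourierCoeffOn_zero_one_eq] at h
  simpa using h

theorem log_Gamma_sq_eq {q : ℝ} (hq : q ∈ Set.Ioc (0 : ℝ) 1) :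
    ((Real.log (Real.Gamma q) ^ 2 : ℝ) : ℂ) = negapolygamma 1 q * negapolygamma 1 q +
      (Real.log (2 * Real.pi) : ℂ) * negapolygamma 1 q + (Real.log (2 * Real.pi) : ℂ) ^ 2 / 4 := by
  rw [negapolygamma_one hq.1 hq.2]
  push_cast
  ring

theorem mainTheorem10 :
    (∀ k k' : ℕ, 1 ≤ k → 1 ≤ k' →
      IntervalIntegrable (fun q : ℝ => negapolygamma k q * negapolygamma k' q)
        MeasureTheory.volume 0 1 ∧
      ∫ q in (0 : ℝ)..1, negapolygamma k q * negapolygamma k' q =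
        2 * (Real.cos (((k : ℝ) - (k' : ℝ)) * (Real.pi / 2)) : ℂ) /
            (2 * (Real.pi : ℂ)) ^ (k + k') *
          (iteratedDeriv 2 riemannZeta ((k : ℂ) + (k' : ℂ))
            - 2 * ((Real.eulerMascheroniConstant : ℂ) + (Real.log (2 * Real.pi) : ℂ)) *
                deriv riemannZeta ((k : ℂ) + (k' : ℂ))
            + (((Real.eulerMascheroniConstant : ℂ) + (Real.log (2 * Real.pi) : ℂ)) ^ 2
                + (Real.pi : ℂ) ^ 2 / 4) * riemannZeta ((k : ℂ) + (k' : ℂ)))) ∧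
    IntervalIntegrable (fun q : ℝ => Real.log (Real.Gamma q) ^ 2) MeasureTheory.volume 0 1 ∧
    ((∫ q in (0 : ℝ)..1, Real.log (Real.Gamma q) ^ 2 : ℝ) : ℂ) =
      (Real.eulerMascheroniConstant : ℂ) ^ 2 / 12 + (Real.pi : ℂ) ^ 2 / 48
        + 1 / 3 * (Real.eulerMascheroniConstant : ℂ) * (Real.log (Real.sqrt (2 * Real.pi)) : ℂ)
        + 4 / 3 * (Real.log (Real.sqrt (2 * Real.pi)) : ℂ) ^ 2
        - ((Real.eulerMascheroniConstant : ℂ) + 2 * (Real.log (Real.sqrt (2 * Real.pi)) : ℂ)) *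
            (deriv riemannZeta 2 / (Real.pi : ℂ) ^ 2)
        + iteratedDeriv 2 riemannZeta 2 / (2 * (Real.pi : ℂ) ^ 2) := by
  have hint : ∀ k k' : ℕ, 1 ≤ k → 1 ≤ k' →
      IntervalIntegrable (fun q : ℝ => negapolygamma k q * negapolygamma k' q)
        MeasureTheory.volume 0 1 := fun k k' hk hk' =>
    (intervalIntegrable_iff_integrableOn_Ioc_of_le zero_le_one).mpr
      ((memLp_negapolygamma hk).integrable_mul (memLp_negapolygamma hk'))
  have hint1 : IntervalIntegrable (negapolygamma 1) MeasureTheory.volume 0 1 :=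
    (intervalIntegrable_iff_integrableOn_Ioc_of_le zero_le_one).mpr
      ((memLp_negapolygamma le_rfl).integrable one_le_two)
  have hsum := (hint 1 1 le_rfl le_rfl).add (hint1.const_mul (Real.log (2 * Real.pi) : ℂ))
  have hsq : Set.EqOn (fun q : ℝ => ((Real.log (Real.Gamma q) ^ 2 : ℝ) : ℂ))
      (fun q => negapolygamma 1 q * negapolygamma 1 q +
        (Real.log (2 * Real.pi) : ℂ) * negapolygamma 1 q + (Real.log (2 * Real.pi) : ℂ) ^ 2 / 4)
      (Set.uIoc 0 1) := fun q hq => by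
    rw [Set.uIoc_of_le zero_le_one] at hq
    exact log_Gamma_sq_eq hq
  refine ⟨fun k k' hk hk' => ⟨hint k k' hk hk', integral_negapolygamma_mul hk hk'⟩, ?_, ?_⟩
  · have h : IntervalIntegrable (fun q : ℝ => ((Real.log (Real.Gamma q) ^ 2 : ℝ) : ℂ))
        MeasureTheory.volume 0 1 :=
      (hsum.add intervalIntegrable_const).congr fun q hq => (hsq hq).symm
    exact ⟨h.1.re, h.2.re⟩
  -- The term linear in ψ^{(-1)} integrates to zero; ζ(2) = π²/6 then turns the remaining constants
  -- into the stated ones.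
  · rw [← intervalIntegral.integral_ofReal, intervalIntegral.integral_congr_ae
        (Filter.Eventually.of_forall hsq),
      intervalIntegral.integral_add hsum intervalIntegrable_const,
      intervalIntegral.integral_add (hint 1 1 le_rfl le_rfl) (hint1.const_mul _),
      intervalIntegral.integral_const_mul, integral_negapolygamma_one,
      integral_negapolygamma_mul le_rfl le_rfl, intervalIntegral.integral_const,
      Real.log_sqrt (by positivity)]
    have hpi : (Real.pi : ℂ) ≠ 0 := by exact_mod_cast Real.pi_ne_zero
    simp only [Nat.cast_one, one_add_one_eq_two, riemannZeta_two, sub_self, zero_mul, Real.cos_zero,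
      Complex.ofReal_one, Complex.ofReal_div, Complex.ofReal_ofNat, sub_zero, one_smul]
    field_simp
    ring
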